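/- **Hybrid systems.** Let $Q$ be a finite set of modes, $E\subseteq Q\times Q$ a set of edges, and let $\mathbf R[x]$ be the real polynomials in $x=(x_1,\dots,x_n)$. Let $H=(Q,E,D,F,G,R)$ be a hybrid system with domains $D_q=\{x\in\mathbb R^n: g_{q,k}(x)\ge 0,\ 1\le k\le K_q\}$ for $q\in Q$, vector fields $f_q\in\mathbf R[x]^n$, guards $G_e=\{x\in\mathbb R^n: h_{e,0}(x)=0,\ h_{e,l}(x)\ge 0,\ 1\le l\le N_e\}$ and reset maps $\phi_e\in\mathbf R[x]^n$ for $e\in E$, where $g_{q,k},h_{e,l}\in\mathbf R[x]$, and where $G_e\subseteq D_q$ and $\phi_e(G_e)\subseteq D_{q'}$ for $e=(q,q')\in E$. Assume that $H$ is cyclic: every mode is the start of exactly one edge and the end of exactly one edge, and the digraph $(Q,E)$ is connected. Let $z=\{z_q\}_{q\in Q}$ be a Zeno equilibrium: $z_q\in D_q$ and $f_q(z_q)\ne 0$ for all $q$, and $z_q\in G_e$, $\phi_e(z_q)=z_{q'}$ for all $e=(q,q')\in E$. Let $w_{qk}\in\mathbf R[x]$ ($q\in Q$, $1\le k\le K_{qw}$)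 be such that $W_q=\{x\in D_q: w_{qk}(x)\ge 0,\ 1\le k\le K_{qw}\}$ is a neighborhood of $z_q$ in $D_q$ for every $q$. **Executions.** An execution from $(q_0,x_0)$, $x_0\in D_{q_0}$, consists of finitely many ($i=0,\dots,N$) or infinitely many ($i\in\mathbb N$) consecutive intervals $T_i\subseteq[0,\infty)$ with minimum $\tau_i$, where $\tau_0=0$ and $T_i=[\tau_i,\tau_{i+1}]$ (possibly a single point) unless $T_i$ is the last interval, which may be closed or right-open, bounded or unbounded; of modes $p(i)\in Q$; and of continuous $c_i:T_i\to D_{p(i)}$ with $\dot c_i=f_{p(i)}(c_i)$ in the interior of $T_i$, such that $p(0)=q_0$, $c_0(0)=x_0$, and, whenever $T_{i+1}$ exists, $e=(p(i),p(i+1))\in E$, $c_i(\tau_{i+1})\in G_e$ and $c_{i+1}(\tau_{i+1})=\phi_e(c_i(\tau_{i+1}))$. It is *maximal* if it has no proper extension, *infinite* if it has infinitely many intervals or an unbounded last interval, and *Zeno* if it has infinitely many intervals and $\lim_i\tau_i<\infty$. It *converges to $z$* if for every $\epsilon>0$ there is an $M$ with $\|c_i(\tau_{i+1})-z_{p(i)}\|\le\epsilon$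 for all $i>M$. $z$ is *Zeno stable* if there are neighborhoods $Z_q$ of $z_q$ in $D_q$ ($q\in Q$) such that for all $q_0\in Q$ and $x_0\in Z_{q_0}$ a maximal execution from $(q_0,x_0)$ exists and every such execution is Zeno and converges to $z$. $H$ is *non-blocking near $z$* if for every $q$ and every $x\in D_q$ sufficiently close to $z_q$, either $x\in G_e$ for some $e\in E$ with start $q$, or for some $\delta>0$ there is a solution $y:[0,\delta]\to D_q$ of $\dot y=f_q(y)$ with $y(0)=x$. **Feasibility Problem 1.** Let $\Sigma_x\subset\mathbf R[x]$ be the set of sums of squares of polynomials. Suppose that there exist $V_q\in\mathbf R[x]$, $a_{qk},c_{qk},i_{qk}\in\Sigma_x$ ($1\le k\le K_{qw}$) and $b_{qk},d_{qk},j_{qk}\in\Sigma_x$ ($1\le k\le K_q$) for $q\in Q$; $m_{e,0}\in\mathbf R[x]$ and $m_{e,l}\in\Sigma_x$ ($1\le l\le N_e$) for $e\in E$; and constants $\alpha,\gamma>0$ and $r_q\in(0,1]$ ($q\in Q$) with $r_q<1$ for some $q$, such that $$V_q-\alpha x^Tx-\sum_k a_{qk}w_{qk}-\sum_k b_{qk}g_{q,k}\in\Sigma_x\quad\text{and}\quad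 V_q(z_q)=0\qquad(q\in Q),$$ $$-\nabla V_q^Tf_q-\gamma-\sum_k c_{qk}w_{qk}-\sum_k d_{qk}g_{q,k}\in\Sigma_x\qquad(q\in Q),$$ $$r_qV_q-V_{q'}(\phi_e)-m_{e,0}h_{e,0}-\sum_l m_{e,l}h_{e,l}-\sum_k i_{qk}w_{qk}-\sum_k j_{qk}g_{q,k}\in\Sigma_x\qquad(e=(q,q')\in E).$$ **Theorem.** Under these assumptions there are neighborhoods $Z_q$ of $z_q$ in $D_q$ ($q\in Q$) such that every infinite execution from any $(q_0,x_0)$ with $x_0\in Z_{q_0}$ is Zeno and converges to $z$; and if moreover $H$ is non-blocking near $z$, then $z$ is Zeno stable. -/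

import Mathlib

open Filter Topology

noncomputable section

/-- A hybrid system with polynomial vector fields and resets and with semialgebraic domains and
guards, with set of modes `Q` and continuous states in `ℝⁿ`.  An edge is a pair `(q, q')` of modes,
with start `q` and end `q'`; the values of `N`, `h`, `phi` at pairs which are not edges play no
role. -/
structure HybridSystem (Q : Type*) (n : ℕ) where
  /-- the set of edges `E ⊆ Q × Q` -/
  edges : Set (Q × Q)
  /-- the number of inequalities defining the domain of a mode -/
  K : Q → ℕ
  /-- the polynomials `g_{q,k}` defining the domains -/
  g : (q : Q) → Fin (K q) → MvPolynomial (Fin n) ℝ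
  /-- the components of the vector fields `f_q` -/
  f : Q → Fin n → MvPolynomial (Fin n) ℝ
  /-- the number of inequalities defining the guard of an edge -/
  N : Q × Q → ℕ
  /-- the polynomials `h_{e,0}` of the equality constraints of the guards -/
  hZero : Q × Q → MvPolynomial (Fin n) ℝ
  /-- the polynomials `h_{e,l}`, `l ≥ 1`, of the inequality constraints of the guards -/
  h : (e : Q × Q) → Fin (N e) → MvPolynomial (Fin n) ℝ
  /-- the components of the reset maps `φ_e` -/
  phi : Q × Q → Fin n → MvPolynomial (Fin n) ℝ
  /-- the guard of an edge lies in the domain of its start: `G_e ⊆ D_q` -/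
  guard_subset : ∀ e ∈ edges, ∀ x : EuclideanSpace ℝ (Fin n),
    MvPolynomial.eval x (hZero e) = 0 → (∀ l, 0 ≤ MvPolynomial.eval x (h e l)) →
      ∀ k, 0 ≤ MvPolynomial.eval x (g e.1 k)
  /-- the reset map of an edge sends its guard to the domain of its end: `φ_e : G_e → D_{q'}` -/
  reset_mem : ∀ e ∈ edges, ∀ x : EuclideanSpace ℝ (Fin n),
    MvPolynomial.eval x (hZero e) = 0 → (∀ l, 0 ≤ MvPolynomial.eval x (h e l)) →
      ∀ k, 0 ≤ MvPolynomial.eval (fun j => MvPolynomial.eval x (phi e j)) (g e.2 k)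

namespace HybridSystem

variable {Q : Type*} {n : ℕ}

/-- The domain `D_q`. -/
def domain (H : HybridSystem Q n) (q : Q) : Set (EuclideanSpace ℝ (Fin n)) :=
  {x | ∀ k, 0 ≤ MvPolynomial.eval x (H.g q k)}

/-- The guard set `G_e`. -/
def guard (H : HybridSystem Q n) (e : Q × Q) : Set (EuclideanSpace ℝ (Fin n)) :=
  {x | MvPolynomial.eval x (H.hZero e) = 0 ∧ ∀ l, 0 ≤ MvPolynomial.eval x (H.h e l)}

/-- The vector field `f_q`. -/
def field (H : HybridSystem Q n) (q : Q) (x : EuclideanSpace ℝ (Fin n)) :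
    EuclideanSpace ℝ (Fin n) :=
  WithLp.toLp 2 fun j => MvPolynomial.eval x (H.f q j)

/-- The reset map `φ_e`. -/
def reset (H : HybridSystem Q n) (e : Q × Q) (x : EuclideanSpace ℝ (Fin n)) :
    EuclideanSpace ℝ (Fin n) :=
  WithLp.toLp 2 fun j => MvPolynomial.eval x (H.phi e j)

/-- A cyclic hybrid system: every mode is the start of exactly one edge and the end of exactly one
edge, and the digraph of modes and edges is connected. -/
structure IsCyclic (H : HybridSystem Q n) : Prop where
  existsUnique_out : ∀ q, ∃! e, e ∈ H.edges ∧ e.1 = q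
  existsUnique_in : ∀ q, ∃! e, e ∈ H.edges ∧ e.2 = q
  connected : ∀ q q', Relation.EqvGen (fun a b => (a, b) ∈ H.edges) q q'

/-- A Zeno equilibrium `z = {z_q}`. -/
structure IsZenoEquilibrium (H : HybridSystem Q n) (z : Q → EuclideanSpace ℝ (Fin n)) :
    Prop where
  mem_domain : ∀ q, z q ∈ H.domain q
  mem_guard : ∀ e ∈ H.edges, z e.1 ∈ H.guard e
  reset_eq : ∀ e ∈ H.edges, H.reset e (z e.1) = z e.2
  field_ne_zero : ∀ q, H.field q (z q) ≠ 0

/-- An execution.  The index set of its time intervals is `{i : ℕ | i < len}`, where `len` may be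
infinite.  The `i`-th interval `T i` starts at `τ i` and, unless it is the last one, is the closed
interval from `τ i` to `τ (i + 1)`, which may be a single point; the last interval, if there is
one, may be closed or right-open, bounded or not.  The values of the data at indices `i ≥ len`,
and those of `c i` outside `T i`, play no role. -/
structure Execution (H : HybridSystem Q n) where
  len : ℕ∞
  τ : ℕ → ℝ
  T : ℕ → Set ℝ
  p : ℕ → Q
  c : ℕ → ℝ → EuclideanSpace ℝ (Fin n)
  len_pos : 0 < len
  τ_zero : τ 0 = 0
  ordConnected : ∀ i : ℕ, (i : ℕ∞) < len → (T i).OrdConnected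
  isLeast : ∀ i : ℕ, (i : ℕ∞) < len → IsLeast (T i) (τ i)
  isGreatest : ∀ i : ℕ, ((i + 1 : ℕ) : ℕ∞) < len → IsGreatest (T i) (τ (i + 1))
  continuousOn : ∀ i : ℕ, (i : ℕ∞) < len → ContinuousOn (c i) (T i)
  hasDerivAt : ∀ i : ℕ, (i : ℕ∞) < len → ∀ t ∈ interior (T i),
    HasDerivAt (c i) (H.field (p i) (c i t)) t
  mem_domain : ∀ i : ℕ, (i : ℕ∞) < len → ∀ t ∈ T i, c i t ∈ H.domain (p i)
  edge_mem : ∀ i : ℕ, ((i + 1 : ℕ) : ℕ∞) < len → (p i, p (i + 1)) ∈ H.edges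
  mem_guard : ∀ i : ℕ, ((i + 1 : ℕ) : ℕ∞) < len →
    c i (τ (i + 1)) ∈ H.guard (p i, p (i + 1))
  reset_eq : ∀ i : ℕ, ((i + 1 : ℕ) : ℕ∞) < len →
    c (i + 1) (τ (i + 1)) = H.reset (p i, p (i + 1)) (c i (τ (i + 1)))

namespace Execution

variable {H : HybridSystem Q n}

/-- The execution has initial condition `(q₀, x₀)`. -/
def StartsAt (χ : H.Execution) (q₀ : Q) (x₀ : EuclideanSpace ℝ (Fin n)) : Prop :=
  χ.p 0 = q₀ ∧ χ.c 0 0 = x₀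

/-- `χ'` extends `χ` (not necessarily properly). -/
def IsPrefix (χ χ' : H.Execution) : Prop :=
  χ.len ≤ χ'.len ∧ ∀ i : ℕ, (i : ℕ∞) < χ.len →
    χ'.p i = χ.p i ∧ χ'.τ i = χ.τ i ∧ χ.T i ⊆ χ'.T i ∧ Set.EqOn (χ.c i) (χ'.c i) (χ.T i)

/-- A maximal execution: one that has no proper extension. -/
def IsMaximal (χ : H.Execution) : Prop :=
  ∀ χ' : H.Execution, χ.IsPrefix χ' → χ'.IsPrefix χ

/-- An infinite execution: one with infinitely many transitions, or defined for all time. -/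
def IsInfinite (χ : H.Execution) : Prop :=
  χ.len = ⊤ ∨ ∃ i : ℕ, (i : ℕ∞) < χ.len ∧ ¬ BddAbove (χ.T i)

/-- A Zeno execution: infinitely many transitions in finite time. -/
def IsZeno (χ : H.Execution) : Prop :=
  χ.len = ⊤ ∧ ∃ t : ℝ, Tendsto χ.τ atTop (𝓝 t)

/-- For every `ε` there is an `M` such that for `i > M` the state at the end of the `i`-th
interval is `ε`-close to the point of `z` in the current mode. -/
def ConvergesTo (χ : H.Execution) (z : Q → EuclideanSpace ℝ (Fin n)) : Prop :=
  ∀ ε : ℝ, 0 < ε → ∃ M : ℕ, ∀ i : ℕ, M < i → ‖χ.c i (χ.τ (i + 1)) - z (χ.p i)‖ ≤ ε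

end Execution

/-- `z` is Zeno stable: for all initial conditions in suitable neighborhoods `Z_q` of the `z_q` (in
`D_q`), the execution, that is, every maximal one (and there is one), is Zeno and converges
to `z`. -/
def ZenoStable (H : HybridSystem Q n) (z : Q → EuclideanSpace ℝ (Fin n)) : Prop :=
  ∃ Z : Q → Set (EuclideanSpace ℝ (Fin n)),
    (∀ q, Z q ⊆ H.domain q ∧ z q ∈ Z q ∧ Z q ∈ 𝓝[H.domain q] (z q)) ∧
    ∀ q₀, ∀ x₀ ∈ Z q₀,
      (∃ χ : H.Execution, χ.StartsAt q₀ x₀ ∧ χ.IsMaximal) ∧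
      ∀ χ : H.Execution, χ.StartsAt q₀ x₀ → χ.IsMaximal → χ.IsZeno ∧ χ.ConvergesTo z

/-- Zeno stability with respect to infinite executions: the same requirement for the infinite
executions only, whose existence is not part of the claim. -/
def ZenoStableForInfinite (H : HybridSystem Q n) (z : Q → EuclideanSpace ℝ (Fin n)) : Prop :=
  ∃ Z : Q → Set (EuclideanSpace ℝ (Fin n)),
    (∀ q, Z q ⊆ H.domain q ∧ z q ∈ Z q ∧ Z q ∈ 𝓝[H.domain q] (z q)) ∧
    ∀ q₀, ∀ x₀ ∈ Z q₀, ∀ χ : H.Execution, χ.StartsAt q₀ x₀ → χ.IsInfinite →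
      χ.IsZeno ∧ χ.ConvergesTo z

/-- The system does not block near `z`: from every state `x ∈ D_q` close to `z_q`, either a
transition is enabled or continuous evolution inside `D_q` is possible for some positive time. -/
def NonBlockingNear (H : HybridSystem Q n) (z : Q → EuclideanSpace ℝ (Fin n)) : Prop :=
  ∀ q, ∀ᶠ x in 𝓝[H.domain q] (z q),
    (∃ e ∈ H.edges, e.1 = q ∧ x ∈ H.guard e) ∨
    ∃ δ : ℝ, 0 < δ ∧ ∃ y : ℝ → EuclideanSpace ℝ (Fin n), y 0 = x ∧
      ContinuousOn y (Set.Icc 0 δ) ∧ (∀ t ∈ Set.Ioo 0 δ, HasDerivAt y (H.field q (y t)) t) ∧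
      ∀ t ∈ Set.Icc 0 δ, y t ∈ H.domain q

/-- The set `W_q = {x ∈ D_q | w_{qk}(x) ≥ 0 for all k}`. -/
def nbhd (H : HybridSystem Q n) {Kw : Q → ℕ}
    (w : (q : Q) → Fin (Kw q) → MvPolynomial (Fin n) ℝ) (q : Q) :
    Set (EuclideanSpace ℝ (Fin n)) :=
  {x | x ∈ H.domain q ∧ ∀ k, 0 ≤ MvPolynomial.eval x (w q k)}

/-- A solution of the feasibility problem for the system `H`, the points `z_q` and the polynomials
`w_{qk}`.  `IsSumSq` says that a polynomial is a sum of squares of polynomials. -/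
structure FeasibilitySolution (H : HybridSystem Q n) (z : Q → EuclideanSpace ℝ (Fin n))
    {Kw : Q → ℕ} (w : (q : Q) → Fin (Kw q) → MvPolynomial (Fin n) ℝ) where
  V : Q → MvPolynomial (Fin n) ℝ
  a : (q : Q) → Fin (Kw q) → MvPolynomial (Fin n) ℝ
  b : (q : Q) → Fin (H.K q) → MvPolynomial (Fin n) ℝ
  c : (q : Q) → Fin (Kw q) → MvPolynomial (Fin n) ℝ
  d : (q : Q) → Fin (H.K q) → MvPolynomial (Fin n) ℝ
  i : (q : Q) → Fin (Kw q) → MvPolynomial (Fin n) ℝ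
  j : (q : Q) → Fin (H.K q) → MvPolynomial (Fin n) ℝ
  mZero : Q × Q → MvPolynomial (Fin n) ℝ
  m : (e : Q × Q) → Fin (H.N e) → MvPolynomial (Fin n) ℝ
  α : ℝ
  γ : ℝ
  r : Q → ℝ
  a_sos : ∀ q k, IsSumSq (a q k)
  b_sos : ∀ q k, IsSumSq (b q k)
  c_sos : ∀ q k, IsSumSq (c q k)
  d_sos : ∀ q k, IsSumSq (d q k)
  i_sos : ∀ q k, IsSumSq (i q k)
  j_sos : ∀ q k, IsSumSq (j q k)
  m_sos : ∀ e ∈ H.edges, ∀ l, IsSumSq (m e l)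
  α_pos : 0 < α
  γ_pos : 0 < γ
  r_mem : ∀ q, r q ∈ Set.Ioc (0 : ℝ) 1
  r_lt_one : ∃ q, r q < 1
  /-- `V_q - α xᵀx - ∑ a_{qk} w_{qk} - ∑ b_{qk} g_{qk}` is a sum of squares -/
  V_sos : ∀ q, IsSumSq (V q - MvPolynomial.C α * ∑ s, MvPolynomial.X s ^ 2
    - ∑ k, a q k * w q k - ∑ k, b q k * H.g q k)
  V_zero : ∀ q, MvPolynomial.eval (z q) (V q) = 0
  /-- `-∇V_qᵀ f_q - γ - ∑ c_{qk} w_{qk} - ∑ d_{qk} g_{qk}` is a sum of squares -/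
  dV_sos : ∀ q, IsSumSq (-(∑ s, MvPolynomial.pderiv s (V q) * H.f q s) - MvPolynomial.C γ
    - ∑ k, c q k * w q k - ∑ k, d q k * H.g q k)
  /-- `r_q V_q - V_{q'}(φ_e) - m_{e,0} h_{e,0} - ∑ m_{e,l} h_{e,l} - ∑ i_{qk} w_{qk}
  - ∑ j_{qk} g_{qk}` is a sum of squares for every edge `e = (q, q')` -/
  reset_sos : ∀ e ∈ H.edges, IsSumSq (MvPolynomial.C (r e.1) * V e.1
    - MvPolynomial.bind₁ (H.phi e) (V e.2) - mZero e * H.hZero e - ∑ l, m e l * H.h e l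
    - ∑ k, i e.1 k * w e.1 k - ∑ k, j e.1 k * H.g e.1 k)

end HybridSystem

end

/-! The sum-of-squares certificates make the `V_q` a family of Lyapunov functions. On `W_q` one has
`V_q ≥ α‖x‖²`, `V_q` falls at rate at least `γ` along the flow, and a jump multiplies it by at most
`r_q ≤ 1`. Since `V_q(z_q) = 0`, the first bound forces every `z_q` to be the origin
(`eq_zero_of_mem_nbhd`).

These inequalities hold only on `W_q`, so an execution must first be confined there. Sets `‖x‖ < ε`,
`V_q < κ` in `D_q` do this: a flow leaving the ball would first reach `‖x‖ = ε`, where `V_q ≥ αε² ≥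
κ`, and for small `κ` a jump cannot leave the ball either (`exists_isTrapping`,
`IsTrapping.norm_lt`). For a trapped execution `V + γt` never increases, so all times are at most
`V(x₀)/γ`; an infinite execution therefore has infinitely many jumps in bounded time. A cyclic
system visits a mode with `r_q < 1` infinitely often, so `V` tends to `0`, and with it the state
(`tendsto_eval_V`).

For Zeno stability, maximal executions exist by Zorn's lemma. A trapped one with a bounded last
interval has bounded velocity there, so that interval is closed; non-blocking then allows a further
jump or flow, contradicting maximality (`IsMaximal.isInfinite`). -/

theorem IsSumSq.eval_nonneg {σ : Type*} {p : MvPolynomial σ ℝ} (hp : IsSumSq p) (x : σ → ℝ) :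
    0 ≤ MvPolynomial.eval x p := by
  induction hp with
  | zero => simp
  | sq_add a _ ih => simpa using add_nonneg (mul_self_nonneg _) ih

theorem MvPolynomial.hasDerivAt_eval {σ : Type*} [Fintype σ] (p : MvPolynomial σ ℝ)
    {x : ℝ → σ → ℝ} {v : σ → ℝ} {t : ℝ} (hx : ∀ s, HasDerivAt (fun u => x u s) (v s) t) :
    HasDerivAt (fun u => eval (x u) p) (∑ s, eval (x t) (pderiv s p) * v s) t := by
  classical
  induction p using MvPolynomial.induction_on with
  | C a => simpa using hasDerivAt_const t a
  | add p q hp hq =>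
    simp only [map_add, add_mul, Finset.sum_add_distrib]
    exact hp.add hq
  | mul_X p j hp =>
    have h := hp.mul (hx j)
    simp only [map_mul, eval_X]
    refine h.congr_deriv ?_
    simp only [Derivation.leibniz, smul_eq_mul, pderiv_X, map_add, map_mul, eval_X, add_mul,
      Finset.sum_add_distrib, Finset.sum_mul]
    rw [add_comm]
    congr 1
    · rw [Finset.sum_eq_single j]
      · simp
      · intro b _ hb
        simp [hb.symm]
      · simp
    · exact Finset.sum_congr rfl fun s _ => by ring

/-! ### Pointwise inequalities from the certificates -/

namespace HybridSystem

variable {Q : Type*} {n : ℕ} {H : HybridSystem Q n} {z : Q → EuclideanSpace ℝ (Fin n)}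
  {Kw : Q → ℕ} {w : (q : Q) → Fin (Kw q) → MvPolynomial (Fin n) ℝ}

theorem continuous_eval_euclidean (p : MvPolynomial (Fin n) ℝ) :
    Continuous fun x : EuclideanSpace ℝ (Fin n) => MvPolynomial.eval x p :=
  (MvPolynomial.continuous_eval p).comp (PiLp.continuous_ofLp 2 _)

theorem continuous_field (H : HybridSystem Q n) (q : Q) : Continuous (H.field q) :=
  (PiLp.continuous_toLp 2 _).comp (continuous_pi fun _ => continuous_eval_euclidean _)

theorem continuous_reset (H : HybridSystem Q n) (e : Q × Q) : Continuous (H.reset e) :=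
  (PiLp.continuous_toLp 2 _).comp (continuous_pi fun _ => continuous_eval_euclidean _)

theorem isClosed_domain (H : HybridSystem Q n) (q : Q) : IsClosed (H.domain q) := by
  simp only [domain, Set.ofPred_forall]
  exact isClosed_iInter fun k => isClosed_le continuous_const (continuous_eval_euclidean _)

theorem reset_mem_domain {e : Q × Q} (he : e ∈ H.edges) {x : EuclideanSpace ℝ (Fin n)}
    (hx : x ∈ H.guard e) : H.reset e x ∈ H.domain e.2 :=
  H.reset_mem e he x hx.1 hx.2

theorem sum_eval_mul_nonneg {K : ℕ} {a p : Fin K → MvPolynomial (Fin n) ℝ}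
    (ha : ∀ k, IsSumSq (a k)) {x : EuclideanSpace ℝ (Fin n)}
    (hp : ∀ k, 0 ≤ MvPolynomial.eval x (p k)) :
    0 ≤ MvPolynomial.eval x (∑ k, a k * p k) := by
  simp only [map_sum, map_mul]
  exact Finset.sum_nonneg fun k _ => mul_nonneg ((ha k).eval_nonneg _) (hp k)

namespace FeasibilitySolution

variable (S : H.FeasibilitySolution z w)

theorem le_eval_V {q : Q} {x : EuclideanSpace ℝ (Fin n)} (hx : x ∈ H.nbhd w q) :
    S.α * ‖x‖ ^ 2 ≤ MvPolynomial.eval x (S.V q) := by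
  have h := (S.V_sos q).eval_nonneg x
  have h1 := sum_eval_mul_nonneg (S.a_sos q) hx.2
  have h2 := sum_eval_mul_nonneg (S.b_sos q) hx.1
  simp only [map_sub, map_mul, MvPolynomial.eval_C, map_sum, map_pow, MvPolynomial.eval_X]
    at h h1 h2
  rw [EuclideanSpace.real_norm_sq_eq]
  linarith

theorem eval_V_nonneg {q : Q} {x : EuclideanSpace ℝ (Fin n)} (hx : x ∈ H.nbhd w q) :
    0 ≤ MvPolynomial.eval x (S.V q) :=
  (mul_nonneg S.α_pos.le (sq_nonneg _)).trans (S.le_eval_V hx)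

theorem eval_derivative_le {q : Q} {x : EuclideanSpace ℝ (Fin n)} (hx : x ∈ H.nbhd w q) :
    ∑ s, MvPolynomial.eval x (MvPolynomial.pderiv s (S.V q)) * H.field q x s ≤ -S.γ := by
  have h := (S.dV_sos q).eval_nonneg x
  have h1 := sum_eval_mul_nonneg (S.c_sos q) hx.2
  have h2 := sum_eval_mul_nonneg (S.d_sos q) hx.1
  simp only [map_sub, map_neg, map_mul, MvPolynomial.eval_C, map_sum] at h h1 h2
  simp only [field]
  linarith

theorem eval_reset_le {e : Q × Q} (he : e ∈ H.edges) {x : EuclideanSpace ℝ (Fin n)}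
    (hg : x ∈ H.guard e) (hx : x ∈ H.nbhd w e.1) :
    MvPolynomial.eval (H.reset e x) (S.V e.2) ≤ S.r e.1 * MvPolynomial.eval x (S.V e.1) := by
  have h := (S.reset_sos e he).eval_nonneg x
  have h1 := sum_eval_mul_nonneg (S.i_sos e.1) hx.2
  have h2 := sum_eval_mul_nonneg (S.j_sos e.1) hx.1
  have h3 := sum_eval_mul_nonneg (S.m_sos e he) hg.2
  have h4 : MvPolynomial.eval x (MvPolynomial.bind₁ (H.phi e) (S.V e.2))
      = MvPolynomial.eval (H.reset e x) (S.V e.2) :=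
    MvPolynomial.eval₂Hom_bind₁ (RingHom.id ℝ) x (H.phi e) (S.V e.2)
  -- The multiplier of `h_{e,0}` has no sign, but `h_{e,0}` vanishes on the guard.
  simp only [map_sub, h4, map_mul, MvPolynomial.eval_C, hg.1, mul_zero] at h
  simp only [map_mul, map_sum] at h h1 h2 h3
  linarith

/-- The quadratic lower bound on `V_q` is centred at the origin, not at `z_q`, so a zero of `V_q` in
`W_q` can only be the origin. Balls about `0` thus serve for all modes at once. -/
theorem eq_zero_of_mem_nbhd (S : H.FeasibilitySolution z w) {q : Q} (hq : z q ∈ H.nbhd w q) :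
    z q = 0 := by
  have h := S.le_eval_V hq
  rw [S.V_zero] at h
  have := S.α_pos
  have h2 : ‖z q‖ ^ 2 ≤ 0 := by
    by_contra! h3
    nlinarith [mul_pos this h3]
  simpa using h2

/-! ### Trapping sets -/

/-- The part of the strict sublevel set of `V_q` at height `κ` in the domain and in the ball of
radius `ε` about the origin. -/
def sublevel (ε κ : ℝ) (q : Q) : Set (EuclideanSpace ℝ (Fin n)) :=
  {x | x ∈ H.domain q ∧ ‖x‖ < ε ∧ MvPolynomial.eval x (S.V q) < κ}

/-- Conditions on radius and height under which executions do not leave the sublevel sets. -/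
structure IsTrapping (ε κ : ℝ) : Prop where
  mem_nbhd : ∀ q, ∀ x ∈ H.domain q, ‖x‖ ≤ ε → x ∈ H.nbhd w q
  le_mul_sq : κ ≤ S.α * ε ^ 2
  norm_reset_lt : ∀ e ∈ H.edges, ∀ x ∈ S.sublevel ε κ e.1, ‖H.reset e x‖ < ε

theorem sublevel_mem_nhdsWithin {ε κ : ℝ} (hε : 0 < ε) (hκ : 0 < κ) {q : Q} (hz : z q = 0) :
    S.sublevel ε κ q ∈ 𝓝[H.domain q] (z q) := by
  have h1 : ∀ᶠ x in 𝓝 (z q), ‖x‖ < ε :=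
    continuous_norm.continuousAt.eventually_lt_const (by simpa [hz] using hε)
  have h2 : ∀ᶠ x : EuclideanSpace ℝ (Fin n) in 𝓝 (z q), MvPolynomial.eval x (S.V q) < κ :=
    (continuous_eval_euclidean _).continuousAt.eventually_lt_const (by simpa [S.V_zero] using hκ)
  filter_upwards [self_mem_nhdsWithin, h1.filter_mono nhdsWithin_le_nhds,
    h2.filter_mono nhdsWithin_le_nhds] with x hx hx1 hx2 using ⟨hx, hx1, hx2⟩

/-- Finiteness of `Q` gives one radius for all modes and edges. The sets `P` carry any further local
property, such as non-blocking, into the trapping set. -/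
theorem exists_isTrapping [Finite Q] (hz : H.IsZenoEquilibrium z) (h0 : ∀ q, z q = 0)
    (hW : ∀ q, H.nbhd w q ∈ 𝓝[H.domain q] (z q)) {P : Q → Set (EuclideanSpace ℝ (Fin n))}
    (hP : ∀ q, P q ∈ 𝓝[H.domain q] (z q)) :
    ∃ ε κ : ℝ, 0 < ε ∧ 0 < κ ∧ S.IsTrapping ε κ ∧ ∀ q, S.sublevel ε κ q ⊆ P q := by
  have h1 : ∀ᶠ x in 𝓝 (0 : EuclideanSpace ℝ (Fin n)),
      ∀ q, x ∈ H.domain q → x ∈ H.nbhd w q ∧ x ∈ P q := by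
    rw [eventually_all]
    intro q
    have := inter_mem (hW q) (hP q)
    rw [h0 q] at this
    exact eventually_nhdsWithin_iff.1 this
  obtain ⟨ε, hε, hball⟩ := Metric.nhds_basis_closedBall.eventually_iff.1 h1
  have h2 : ∀ᶠ x in 𝓝 (0 : EuclideanSpace ℝ (Fin n)),
      ∀ e : Q × Q, e ∈ H.edges → ‖H.reset e x‖ < ε := by
    rw [eventually_all]
    intro e
    by_cases he : e ∈ H.edges
    · have hr := hz.reset_eq e he
      rw [h0, h0] at hr
      filter_upwards [(H.continuous_reset e).norm.continuousAt.eventually_lt_const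
        (show ‖H.reset e 0‖ < ε by simpa [hr] using hε)] with x hx _ using hx
    · simp [he]
  obtain ⟨δ, hδ, hball'⟩ := Metric.nhds_basis_ball.eventually_iff.1 h2
  have hm : ∀ q, ∀ x ∈ H.domain q, ‖x‖ ≤ ε → x ∈ H.nbhd w q :=
    fun q x hx hxε => (hball (by simpa using hxε) q hx).1
  -- With this height, `α‖x‖² ≤ V_q(x) < κ` gives `‖x‖ < δ`, and resets map the `δ`-ball into the
  -- `ε`-ball.
  refine ⟨ε, S.α * min ε δ ^ 2, hε, by have := S.α_pos; positivity, ⟨hm, ?_, ?_⟩, ?_⟩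
  · have := S.α_pos
    gcongr
    exact min_le_left _ _
  · intro e he x hx
    refine hball' ?_ e he
    have h := (S.le_eval_V (hm _ _ hx.1 hx.2.1.le)).trans_lt hx.2.2
    have h3 := lt_of_pow_lt_pow_left₀ 2 (by positivity) (lt_of_mul_lt_mul_left h S.α_pos.le)
    simpa using h3.trans_le (min_le_right _ _)
  · exact fun q x hx => (hball (by simpa using hx.2.1.le) q hx.1).2

variable {S} {ε κ : ℝ}

theorem IsTrapping.sublevel_subset (hS : S.IsTrapping ε κ) (q : Q) :
    S.sublevel ε κ q ⊆ H.nbhd w q :=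
  fun x hx => hS.mem_nbhd q x hx.1 hx.2.1.le

theorem IsTrapping.reset_mem (hS : S.IsTrapping ε κ) {e : Q × Q} (he : e ∈ H.edges)
    {x : EuclideanSpace ℝ (Fin n)} (hg : x ∈ H.guard e) (hx : x ∈ S.sublevel ε κ e.1) :
    H.reset e x ∈ S.sublevel ε κ e.2 := by
  have hx' := hS.sublevel_subset _ hx
  refine ⟨reset_mem_domain he hg, hS.norm_reset_lt e he x hx,
    (S.eval_reset_le he hg hx').trans_lt (lt_of_le_of_lt ?_ hx.2.2)⟩
  exact mul_le_of_le_one_left (S.eval_V_nonneg hx') (S.r_mem _).2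

/-- The derivative certificate applies while the curve is in the closed ball. Asking this only on
the open interval, with `≤`, permits use up to a first hitting time of the sphere. -/
theorem IsTrapping.antitoneOn (hS : S.IsTrapping ε κ) {q : Q}
    {c : ℝ → EuclideanSpace ℝ (Fin n)} {a b : ℝ}
    (hc : ContinuousOn c (Set.Icc a b))
    (hd : ∀ t ∈ Set.Ioo a b, HasDerivAt c (H.field q (c t)) t)
    (hD : ∀ t ∈ Set.Icc a b, c t ∈ H.domain q) (hε : ∀ t ∈ Set.Ioo a b, ‖c t‖ ≤ ε) :
    AntitoneOn (fun t => MvPolynomial.eval (c t) (S.V q) + S.γ * t) (Set.Icc a b) := by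
  have hd' : ∀ t ∈ Set.Ioo a b, HasDerivAt (fun t => MvPolynomial.eval (c t) (S.V q) + S.γ * t)
      (∑ s, MvPolynomial.eval (c t) (MvPolynomial.pderiv s (S.V q)) * H.field q (c t) s
        + S.γ * 1) t := by
    intro t ht
    refine (MvPolynomial.hasDerivAt_eval (S.V q) (x := fun t => c t) fun s => ?_).add
      ((hasDerivAt_id t).const_mul S.γ)
    exact ((EuclideanSpace.proj s : EuclideanSpace ℝ (Fin n) →L[ℝ] ℝ).hasFDerivAt.comp_hasDerivAt
      t (hd t ht))
  apply antitoneOn_of_deriv_nonpos (convex_Icc a b)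
  · exact ((continuous_eval_euclidean _).comp_continuousOn hc).add (by fun_prop)
  · rw [interior_Icc]
    exact fun t ht => (hd' t ht).differentiableAt.differentiableWithinAt
  · rw [interior_Icc]
    intro t ht
    rw [(hd' t ht).deriv]
    have := S.eval_derivative_le
      (hS.mem_nbhd q _ (hD t (Set.Ioo_subset_Icc_self ht)) (hε t ht))
    linarith

/-- At the first time on the sphere `‖x‖ = ε`, `V_q` would be at least `αε² ≥ κ`, although it has
not increased from a value below `κ`. -/
theorem IsTrapping.norm_lt (hS : S.IsTrapping ε κ) {q : Q}
    {c : ℝ → EuclideanSpace ℝ (Fin n)} {a b : ℝ}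
    (hc : ContinuousOn c (Set.Icc a b))
    (hd : ∀ t ∈ Set.Ioo a b, HasDerivAt c (H.field q (c t)) t)
    (hD : ∀ t ∈ Set.Icc a b, c t ∈ H.domain q) (ha : c a ∈ S.sublevel ε κ q) :
    ∀ t ∈ Set.Icc a b, ‖c t‖ < ε := by
  by_contra! hcon
  obtain ⟨t, ht, htε⟩ := hcon
  have ivt : ∀ t ∈ Set.Icc a b, ε ≤ ‖c t‖ → ∃ s ∈ Set.Icc a t, ‖c s‖ = ε := fun t ht htε =>
    intermediate_value_Icc ht.1 (hc.mono (Set.Icc_subset_Icc_right ht.2)).norm ⟨ha.2.1.le, htε⟩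
  have hcomp : IsCompact (Set.Icc a b ∩ (fun t => ‖c t‖) ⁻¹' {ε}) :=
    isCompact_Icc.of_isClosed_subset
      (hc.norm.preimage_isClosed_of_isClosed isClosed_Icc isClosed_singleton)
      Set.inter_subset_left
  obtain ⟨s, hs, hsε⟩ := ivt t ht htε
  -- The first hitting time; before it the curve is inside the ball by the intermediate value
  -- theorem.
  obtain ⟨u, ⟨hu, huε⟩, hmin⟩ := hcomp.exists_isLeast ⟨s, ⟨hs.1, hs.2.trans ht.2⟩, hsε⟩
  have hlt : ∀ t ∈ Set.Ioo a u, ‖c t‖ ≤ ε := by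
    intro t ht
    by_contra! hcon
    obtain ⟨v, hv, hvε⟩ := ivt t ⟨ht.1.le, ht.2.le.trans hu.2⟩ hcon.le
    have := hmin ⟨⟨hv.1, hv.2.trans (ht.2.le.trans hu.2)⟩, hvε⟩
    linarith [hv.2, ht.2]
  have hsub : Set.Icc a u ⊆ Set.Icc a b := Set.Icc_subset_Icc_right hu.2
  have hanti := hS.antitoneOn (hc.mono hsub)
    (fun t ht => hd t ⟨ht.1, ht.2.trans_le hu.2⟩) (fun t ht => hD t (hsub ht)) hlt
    (Set.left_mem_Icc.2 hu.1) (Set.right_mem_Icc.2 hu.1) hu.1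
  have h1 := S.le_eval_V (hS.mem_nbhd q _ (hD u hu) (le_of_eq huε))
  have h2 : ‖c u‖ = ε := huε
  rw [h2] at h1
  have h3 := mul_le_mul_of_nonneg_left hu.1 S.γ_pos.le
  simp only at hanti
  linarith [ha.2.2, hS.le_mul_sq]

/-- Along a continuous evolution starting in a sublevel set, `V_q` decreases at rate `γ`. -/
theorem IsTrapping.eval_add_le (hS : S.IsTrapping ε κ) {q : Q}
    {c : ℝ → EuclideanSpace ℝ (Fin n)} {a b : ℝ}
    (hab : a ≤ b) (hc : ContinuousOn c (Set.Icc a b))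
    (hd : ∀ t ∈ Set.Ioo a b, HasDerivAt c (H.field q (c t)) t)
    (hD : ∀ t ∈ Set.Icc a b, c t ∈ H.domain q) (ha : c a ∈ S.sublevel ε κ q) :
    c b ∈ S.sublevel ε κ q ∧ MvPolynomial.eval (c b) (S.V q) + S.γ * b
      ≤ MvPolynomial.eval (c a) (S.V q) + S.γ * a := by
  have hlt := hS.norm_lt hc hd hD ha
  have h := hS.antitoneOn hc hd hD (fun t ht => (hlt t (Set.Ioo_subset_Icc_self ht)).le)
    (Set.left_mem_Icc.2 hab) (Set.right_mem_Icc.2 hab) hab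
  have hb := Set.right_mem_Icc.2 hab
  refine ⟨⟨hD b hb, hlt b hb, ?_⟩, h⟩
  have h3 := mul_le_mul_of_nonneg_left hab S.γ_pos.le
  simp only at h
  linarith [ha.2.2]

end FeasibilitySolution

end HybridSystem

/-! ### Trapped executions: Zeno behaviour and convergence -/

namespace HybridSystem

variable {Q : Type*} {n : ℕ} {H : HybridSystem Q n} {z : Q → EuclideanSpace ℝ (Fin n)}
  {Kw : Q → ℕ} {w : (q : Q) → Fin (Kw q) → MvPolynomial (Fin n) ℝ}

/-- In a finite cyclic system every infinite path meets every mode infinitely often. -/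
theorem IsCyclic.exists_add_eq [Finite Q] (hH : H.IsCyclic) {p : ℕ → Q}
    (hp : ∀ i, (p i, p (i + 1)) ∈ H.edges) (q : Q) (i : ℕ) : ∃ k, p (i + k) = q := by
  choose e he heu using hH.existsUnique_out
  have huniq : ∀ a b, (a, b) ∈ H.edges → b = (e a).2 := fun a b h => by
    rw [← heu a (a, b) ⟨h, rfl⟩]
  have hinj : Function.Injective fun a => (e a).2 := by
    intro a b hab
    have h := (hH.existsUnique_in (e a).2).unique ⟨(he a).1, rfl⟩ ⟨(he b).1, hab.symm⟩
    rw [← (he a).2, ← (he b).2, h]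
  -- Unique incoming edges make the successor map injective, hence a permutation of the finite set
  -- `Q`; connectedness says that it has a single cycle.
  let σ : Equiv.Perm Q := Equiv.ofBijective _ (Finite.injective_iff_bijective.1 hinj)
  have hcycle : ∀ a b, Relation.EqvGen (fun a b => (a, b) ∈ H.edges) a b → σ.SameCycle a b := by
    intro a b h
    induction h with
    | rel a b h => exact ⟨1, by simpa [σ] using (huniq a b h).symm⟩
    | refl a => exact .refl _ _
    | symm _ _ _ ih => exact ih.symm
    | trans _ _ _ _ _ ih1 ih2 => exact ih1.trans ih2
  obtain ⟨k, -, hk⟩ := (hcycle (p i) q (hH.connected _ _)).exists_pow_eq'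
  refine ⟨k, hk ▸ ?_⟩
  clear hk
  induction k with
  | zero => rfl
  | succ k ih =>
    rw [pow_succ', Equiv.Perm.mul_apply, ← ih]
    exact huniq _ _ (hp (i + k))

namespace Execution

variable (χ : H.Execution)

theorem lt_len_of_succ {i : ℕ} (hi : ((i + 1 : ℕ) : ℕ∞) < χ.len) : (i : ℕ∞) < χ.len :=
  lt_of_le_of_lt (by exact_mod_cast i.le_succ) hi

theorem τ_le {i : ℕ} (hi : (i : ℕ∞) < χ.len) {t : ℝ} (ht : t ∈ χ.T i) : χ.τ i ≤ t :=
  (χ.isLeast i hi).2 ht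

theorem Icc_subset {i : ℕ} (hi : (i : ℕ∞) < χ.len) {t : ℝ} (ht : t ∈ χ.T i) :
    Set.Icc (χ.τ i) t ⊆ χ.T i :=
  (χ.ordConnected i hi).out (χ.isLeast i hi).1 ht

theorem Ioo_subset_interior {i : ℕ} (hi : (i : ℕ∞) < χ.len) {t : ℝ} (ht : t ∈ χ.T i) :
    Set.Ioo (χ.τ i) t ⊆ interior (χ.T i) :=
  interior_maximal (Set.Ioo_subset_Icc_self.trans (χ.Icc_subset hi ht)) isOpen_Ioo

variable {χ} {S : H.FeasibilitySolution z w} {ε κ : ℝ}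

theorem mem_sublevel_of_mem (hS : S.IsTrapping ε κ) {i : ℕ} (hi : (i : ℕ∞) < χ.len)
    (h0 : χ.c i (χ.τ i) ∈ S.sublevel ε κ (χ.p i)) {t : ℝ} (ht : t ∈ χ.T i) :
    χ.c i t ∈ S.sublevel ε κ (χ.p i) ∧ MvPolynomial.eval (χ.c i t) (S.V (χ.p i)) + S.γ * t
      ≤ MvPolynomial.eval (χ.c i (χ.τ i)) (S.V (χ.p i)) + S.γ * χ.τ i :=
  hS.eval_add_le (χ.τ_le hi ht) ((χ.continuousOn i hi).mono (χ.Icc_subset hi ht))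
    (fun s hs => χ.hasDerivAt i hi s (χ.Ioo_subset_interior hi ht hs))
    (fun s hs => χ.mem_domain i hi s (χ.Icc_subset hi ht hs)) h0

theorem eval_reset_le (hS : S.IsTrapping ε κ) {i : ℕ} (hi : ((i + 1 : ℕ) : ℕ∞) < χ.len)
    (h : χ.c i (χ.τ (i + 1)) ∈ S.sublevel ε κ (χ.p i)) :
    MvPolynomial.eval (χ.c (i + 1) (χ.τ (i + 1))) (S.V (χ.p (i + 1)))
      ≤ S.r (χ.p i) * MvPolynomial.eval (χ.c i (χ.τ (i + 1))) (S.V (χ.p i)) := by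
  rw [χ.reset_eq i hi]
  exact S.eval_reset_le (χ.edge_mem i hi) (χ.mem_guard i hi) (hS.sublevel_subset _ h)

/-- Flows do not increase `V + γt`, and jumps take no time and do not increase `V`, so both trapping
and the energy bound pass from one interval to the next. -/
theorem mem_sublevel (hS : S.IsTrapping ε κ) (h0 : χ.c 0 0 ∈ S.sublevel ε κ (χ.p 0)) (i : ℕ)
    (hi : (i : ℕ∞) < χ.len) : ∀ t ∈ χ.T i, χ.c i t ∈ S.sublevel ε κ (χ.p i) ∧
      MvPolynomial.eval (χ.c i t) (S.V (χ.p i)) + S.γ * t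
        ≤ MvPolynomial.eval (χ.c 0 0) (S.V (χ.p 0)) := by
  induction i with
  | zero =>
    intro t ht
    have h := mem_sublevel_of_mem hS hi (by rwa [χ.τ_zero]) ht
    simpa [χ.τ_zero] using h
  | succ i ih =>
    intro t ht
    have hi' := χ.lt_len_of_succ hi
    obtain ⟨h1, h2⟩ := ih hi' _ (χ.isGreatest i hi).1
    have h3 := hS.reset_mem (χ.edge_mem i hi) (χ.mem_guard i hi) h1
    rw [← χ.reset_eq i hi] at h3
    obtain ⟨h4, h5⟩ := mem_sublevel_of_mem hS hi h3 ht
    have h6 := eval_reset_le hS hi h1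
    have h7 := mul_le_of_le_one_left (S.eval_V_nonneg (hS.sublevel_subset _ h1))
      (S.r_mem (χ.p i)).2
    exact ⟨h4, by linarith⟩

theorem le_of_mem_T (hS : S.IsTrapping ε κ) (h0 : χ.c 0 0 ∈ S.sublevel ε κ (χ.p 0)) {i : ℕ}
    (hi : (i : ℕ∞) < χ.len) {t : ℝ} (ht : t ∈ χ.T i) :
    t ≤ MvPolynomial.eval (χ.c 0 0) (S.V (χ.p 0)) / S.γ := by
  obtain ⟨h1, h2⟩ := mem_sublevel hS h0 i hi t ht
  rw [le_div_iff₀' S.γ_pos]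
  linarith [S.eval_V_nonneg (hS.sublevel_subset _ h1)]

/-- The end values of `V` decrease to some `L ≥ 0`. Recurrent visits to a mode with `r_q < 1` give
`L ≤ r_q L`, hence `L = 0`. -/
theorem tendsto_eval_V [Finite Q] (hH : H.IsCyclic) (hS : S.IsTrapping ε κ)
    (h0 : χ.c 0 0 ∈ S.sublevel ε κ (χ.p 0)) (hlen : χ.len = ⊤) :
    Tendsto (fun i => MvPolynomial.eval (χ.c i (χ.τ (i + 1))) (S.V (χ.p i))) atTop (𝓝 0) := by
  have hlt : ∀ i : ℕ, (i : ℕ∞) < χ.len := fun i => hlen ▸ ENat.natCast_lt_top i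
  set v := fun i => MvPolynomial.eval (χ.c i (χ.τ (i + 1))) (S.V (χ.p i)) with hv
  have hmem : ∀ i, ∀ t ∈ χ.T i, χ.c i t ∈ S.sublevel ε κ (χ.p i) :=
    fun i t ht => (mem_sublevel hS h0 i (hlt i) t ht).1
  have hend : ∀ i, χ.τ (i + 1) ∈ χ.T i := fun i => (χ.isGreatest i (hlt _)).1
  have hnonneg : ∀ i, 0 ≤ v i := fun i =>
    S.eval_V_nonneg (hS.sublevel_subset _ (hmem i _ (hend i)))
  have hstep : ∀ i, v (i + 1) ≤ S.r (χ.p i) * v i := by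
    intro i
    have h1 := eval_reset_le hS (hlt (i + 1)) (hmem i _ (hend i))
    have h2 := (mem_sublevel_of_mem hS (hlt (i + 1))
      (hmem _ _ (χ.isLeast _ (hlt (i + 1))).1) (hend (i + 1))).2
    have h3 := mul_le_mul_of_nonneg_left (χ.τ_le (hlt (i + 1)) (hend (i + 1))) S.γ_pos.le
    simp only [hv]
    linarith
  have hanti : Antitone v := antitone_nat_of_succ_le fun i =>
    (hstep i).trans (mul_le_of_le_one_left (hnonneg i) (S.r_mem _).2)
  have hbdd : BddBelow (Set.range v) := ⟨0, by rintro _ ⟨i, rfl⟩; exact hnonneg i⟩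
  have hlim := tendsto_atTop_ciInf hanti hbdd
  have hle : ∀ i, ⨅ j, v j ≤ v i := fun i => ciInf_le hbdd i
  have hpos : 0 ≤ ⨅ j, v j := le_ciInf hnonneg
  suffices h : ⨅ j, v j = 0 by rwa [h] at hlim
  obtain ⟨q, hq⟩ := S.r_lt_one
  have hfreq : ∀ i, ⨅ j, v j ≤ S.r q * v i := by
    intro i
    obtain ⟨k, hk⟩ := hH.exists_add_eq (fun i => χ.edge_mem i (hlt _)) q i
    calc ⨅ j, v j ≤ v (i + k + 1) := hle _
      _ ≤ S.r q * v (i + k) := hk ▸ hstep (i + k)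
      _ ≤ S.r q * v i := mul_le_mul_of_nonneg_left (hanti (Nat.le_add_right i k)) (S.r_mem q).1.le
  have := ge_of_tendsto' (hlim.const_mul (S.r q)) hfreq
  nlinarith

theorem isZeno_and_convergesTo [Finite Q] (hH : H.IsCyclic) (hz : ∀ q, z q = 0)
    (hS : S.IsTrapping ε κ) (h0 : χ.c 0 0 ∈ S.sublevel ε κ (χ.p 0)) (hχ : χ.IsInfinite) :
    χ.IsZeno ∧ χ.ConvergesTo z := by
  -- The bound `V(x₀)/γ` on all times excludes an unbounded last interval.
  have hlen : χ.len = ⊤ := hχ.resolve_right fun ⟨i, hi, hb⟩ =>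
    hb ⟨_, fun t ht => le_of_mem_T hS h0 hi ht⟩
  have hlt : ∀ i : ℕ, (i : ℕ∞) < χ.len := fun i => hlen ▸ ENat.natCast_lt_top i
  have hend : ∀ i, χ.τ (i + 1) ∈ χ.T i := fun i => (χ.isGreatest i (hlt _)).1
  refine ⟨⟨hlen, _, tendsto_atTop_ciSup
    (monotone_nat_of_le_succ fun i => χ.τ_le (hlt i) (hend i))
      ⟨MvPolynomial.eval (χ.c 0 0) (S.V (χ.p 0)) / S.γ, ?_⟩⟩, ?_⟩
  · rintro _ ⟨i, rfl⟩
    exact le_of_mem_T hS h0 (hlt i) (χ.isLeast i (hlt i)).1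
  · intro δ hδ
    have h := (tendsto_eval_V hH hS h0 hlen).eventually_lt_const
      (show 0 < S.α * δ ^ 2 from mul_pos S.α_pos (pow_pos hδ 2))
    obtain ⟨M, hM⟩ := eventually_atTop.1 h
    refine ⟨M, fun i hi => ?_⟩
    have h1 := S.le_eval_V (hS.sublevel_subset _ (mem_sublevel hS h0 i (hlt i) _ (hend i)).1)
    rw [hz, sub_zero]
    exact (lt_of_pow_lt_pow_left₀ 2 hδ.le
      (lt_of_mul_lt_mul_left (h1.trans_lt (hM i hi.le)) S.α_pos.le)).le

end Execution

end HybridSystem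

/-! ### Existence of maximal executions -/

theorem exists_forall_eq_of_pairwise_eq {ι α : Type*} [Nonempty α] {P : ι → Prop} {f : ι → α}
    (h : ∀ a b, P a → P b → f a = f b) : ∃ v, ∀ a, P a → f a = v := by
  by_cases hP : ∃ a, P a
  · obtain ⟨a, ha⟩ := hP
    exact ⟨f a, fun b hb => h b a hb ha⟩
  · exact ⟨Classical.arbitrary α, fun a ha => (hP ⟨a, ha⟩).elim⟩

namespace HybridSystem

variable {Q : Type*} {n : ℕ} {H : HybridSystem Q n}

namespace Execution

theorem IsPrefix.refl (χ : H.Execution) : χ.IsPrefix χ :=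
  ⟨le_rfl, fun _ _ => ⟨rfl, rfl, subset_rfl, fun _ _ => rfl⟩⟩

theorem IsPrefix.trans {χ₁ χ₂ χ₃ : H.Execution} (h : χ₁.IsPrefix χ₂) (h' : χ₂.IsPrefix χ₃) :
    χ₁.IsPrefix χ₃ := by
  refine ⟨h.1.trans h'.1, fun i hi => ?_⟩
  obtain ⟨h1, h2, h3, h4⟩ := h.2 i hi
  obtain ⟨h1', h2', h3', h4'⟩ := h'.2 i (hi.trans_le h.1)
  exact ⟨h1'.trans h1, h2'.trans h2, h3.trans h3', fun t ht => (h4 ht).trans (h4' (h3 ht))⟩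

theorem StartsAt.of_isPrefix {χ χ' : H.Execution} {q₀ : Q} {x₀ : EuclideanSpace ℝ (Fin n)}
    (h : χ.StartsAt q₀ x₀) (h' : χ.IsPrefix χ') : χ'.StartsAt q₀ x₀ := by
  have hl : ((0 : ℕ) : ℕ∞) < χ.len := by simpa using χ.len_pos
  obtain ⟨h1, -, -, h2⟩ := h'.2 0 hl
  have h0 : (0 : ℝ) ∈ χ.T 0 := χ.τ_zero ▸ (χ.isLeast 0 hl).1
  exact ⟨h1.trans h.1, (h2 h0).symm.trans h.2⟩

/-- Members of a chain agree wherever both are defined, so modes, times and curves glue; the `i`-th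
interval of the bound is the union of the `i`-th intervals. -/
theorem exists_upperBound_of_isChain {C : Set H.Execution} (hC : IsChain IsPrefix C)
    (hne : C.Nonempty) : ∃ ub : H.Execution, ∀ χ ∈ C, χ.IsPrefix ub := by
  obtain ⟨χ₀, hχ₀⟩ := hne
  have htot : ∀ χ ∈ C, ∀ χ' ∈ C, χ.IsPrefix χ' ∨ χ'.IsPrefix χ := by
    intro χ hχ χ' hχ'
    by_cases h : χ = χ'
    · exact .inl (h ▸ .refl χ)
    · exact hC hχ hχ' h
  have hpair : ∀ i : ℕ, ∀ χ ∈ C, ∀ χ' ∈ C, (i : ℕ∞) < χ.len → (i : ℕ∞) < χ'.len →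
      χ.p i = χ'.p i ∧ χ.τ i = χ'.τ i ∧ (χ.T i ⊆ χ'.T i ∨ χ'.T i ⊆ χ.T i) ∧
        ∀ t, t ∈ χ.T i → t ∈ χ'.T i → χ.c i t = χ'.c i t := by
    intro i χ hχ χ' hχ' hi hi'
    rcases htot χ hχ χ' hχ' with h | h
    · obtain ⟨h1, h2, h3, h4⟩ := h.2 i hi
      exact ⟨h1.symm, h2.symm, .inl h3, fun t ht _ => h4 ht⟩
    · obtain ⟨h1, h2, h3, h4⟩ := h.2 i hi'
      exact ⟨h1, h2, .inr h3, fun t _ ht => (h4 ht).symm⟩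
  have : Nonempty Q := ⟨χ₀.p 0⟩
  have hp : ∀ i : ℕ, ∃ a, ∀ χ : H.Execution, χ ∈ C ∧ (i : ℕ∞) < χ.len → χ.p i = a := fun i =>
    exists_forall_eq_of_pairwise_eq fun χ χ' h h' => (hpair i χ h.1 χ' h'.1 h.2 h'.2).1
  have hτ : ∀ i : ℕ, ∃ a, ∀ χ : H.Execution, χ ∈ C ∧ (i : ℕ∞) < χ.len → χ.τ i = a := fun i =>
    exists_forall_eq_of_pairwise_eq fun χ χ' h h' => (hpair i χ h.1 χ' h'.1 h.2 h'.2).2.1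
  have hc : ∀ (i : ℕ) (t : ℝ), ∃ a, ∀ χ : H.Execution,
      χ ∈ C ∧ (i : ℕ∞) < χ.len ∧ t ∈ χ.T i → χ.c i t = a := fun i t =>
    exists_forall_eq_of_pairwise_eq fun χ χ' h h' =>
      (hpair i χ h.1 χ' h'.1 h.2.1 h'.2.1).2.2.2 t h.2.2 h'.2.2
  choose p hp using hp
  choose τ hτ using hτ
  choose c hc using hc
  let T : ℕ → Set ℝ := fun i => {t | ∃ χ ∈ C, (i : ℕ∞) < χ.len ∧ t ∈ χ.T i}
  have hlen : ∀ i : ℕ, (i : ℕ∞) < (⨆ χ ∈ C, χ.len) → ∃ χ ∈ C, (i : ℕ∞) < χ.len := by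
    intro i hi
    simpa [lt_iSup_iff] using hi
  have hsub : ∀ i : ℕ, ∀ χ ∈ C, (i : ℕ∞) < χ.len → χ.T i ⊆ T i :=
    fun i χ hχ hi t ht => ⟨χ, hχ, hi, ht⟩
  have hIcc : ∀ i : ℕ, ∀ χ ∈ C, (i : ℕ∞) < χ.len → ∀ t ∈ χ.T i, Set.Icc (τ i) t ⊆ χ.T i := by
    intro i χ hχ hi t ht
    rw [← hτ i χ ⟨hχ, hi⟩]
    exact χ.Icc_subset hi ht
  have hτT : ∀ i : ℕ, ∀ t ∈ T i, τ i ≤ t := by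
    rintro i t ⟨χ, hχ, hi, ht⟩
    rw [← hτ i χ ⟨hχ, hi⟩]
    exact χ.τ_le hi ht
  -- Continuity and derivatives are local, so one member covering `T i` near `t` suffices: one
  -- reaching beyond `t`, or, if `t` is the greatest element, one containing `t`.
  have hloc : ∀ i : ℕ, ∀ t ∈ T i, ∃ χ ∈ C, (i : ℕ∞) < χ.len ∧ t ∈ χ.T i ∧ χ.T i ∈ 𝓝[T i] t := by
    intro i t ht
    by_cases h : ∃ t' ∈ T i, t < t'
    · obtain ⟨t', ⟨χ, hχ, hi, ht'⟩, htt'⟩ := h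
      refine ⟨χ, hχ, hi, hIcc i χ hχ hi t' ht' ⟨hτT i t ht, htt'.le⟩, ?_⟩
      filter_upwards [self_mem_nhdsWithin, mem_nhdsWithin_of_mem_nhds (Iio_mem_nhds htt')]
        with s hs hs' using hIcc i χ hχ hi t' ht' ⟨hτT i s hs, hs'.le⟩
    · push Not at h
      obtain ⟨χ, hχ, hi, ht'⟩ := ht
      refine ⟨χ, hχ, hi, ht', ?_⟩
      filter_upwards [self_mem_nhdsWithin]
        with s hs using hIcc i χ hχ hi t ht' ⟨hτT i s hs, h s hs⟩
  have heq : ∀ i : ℕ, ∀ χ ∈ C, (i : ℕ∞) < χ.len → Set.EqOn (χ.c i) (c i) (χ.T i) :=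
    fun i χ hχ hi t ht => hc i t χ ⟨hχ, hi, ht⟩
  have hlt : ∀ {χ : H.Execution} {i : ℕ}, ((i + 1 : ℕ) : ℕ∞) < χ.len → (i : ℕ∞) < χ.len :=
    fun {χ} _ hi => χ.lt_len_of_succ hi
  refine ⟨{
    len := ⨆ χ ∈ C, χ.len, τ := τ, T := T, p := p, c := c
    len_pos := χ₀.len_pos.trans_le (le_iSup₂_of_le χ₀ hχ₀ le_rfl)
    τ_zero := by rw [← hτ 0 χ₀ ⟨hχ₀, by simpa using χ₀.len_pos⟩, χ₀.τ_zero]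
    ordConnected := ?_
    isLeast := ?_
    isGreatest := ?_
    continuousOn := ?_
    hasDerivAt := ?_
    mem_domain := ?_
    edge_mem := ?_
    mem_guard := ?_
    reset_eq := ?_ }, fun χ hχ => ⟨le_iSup₂_of_le χ hχ le_rfl, fun i hi =>
      ⟨(hp i χ ⟨hχ, hi⟩).symm, (hτ i χ ⟨hχ, hi⟩).symm, hsub i χ hχ hi, heq i χ hχ hi⟩⟩⟩
  · rintro i -
    refine ⟨fun s hs t ht u hu => ?_⟩
    obtain ⟨χ, hχ, hi, ht'⟩ := ht
    exact ⟨χ, hχ, hi, hIcc i χ hχ hi t ht' ⟨(hτT i s hs).trans hu.1, hu.2⟩⟩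
  · intro i hi
    obtain ⟨χ, hχ, hi⟩ := hlen i hi
    exact ⟨⟨χ, hχ, hi, hτ i χ ⟨hχ, hi⟩ ▸ (χ.isLeast i hi).1⟩, hτT i⟩
  · intro i hi
    obtain ⟨χ, hχ, hi⟩ := hlen _ hi
    refine ⟨⟨χ, hχ, hlt hi, hτ (i + 1) χ ⟨hχ, hi⟩ ▸ (χ.isGreatest i hi).1⟩, ?_⟩
    rintro t ⟨χ', hχ', hi', ht'⟩
    -- Only a last interval can grow: if `χ'` extends `χ`, it also has an interval `i + 1`, so its
    -- `i`-th one ends at the same time.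
    rcases htot χ hχ χ' hχ' with h | h
    · have hi'' := hi.trans_le h.1
      exact hτ (i + 1) χ' ⟨hχ', hi''⟩ ▸ (χ'.isGreatest i hi'').2 ht'
    · exact hτ (i + 1) χ ⟨hχ, hi⟩ ▸ (χ.isGreatest i hi).2 ((h.2 i hi').2.2.1 ht')
  · intro i _ t ht
    obtain ⟨χ, hχ, hi, ht', hn⟩ := hloc i t ht
    exact (((χ.continuousOn i hi).congr (heq i χ hχ hi).symm) t ht').mono_of_mem_nhdsWithin hn
  · intro i _ t ht
    obtain ⟨χ, hχ, hi, ht', hn⟩ := hloc i t (interior_subset ht)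
    rw [nhdsWithin_eq_nhds.2 (mem_interior_iff_mem_nhds.1 ht)] at hn
    rw [← hp i χ ⟨hχ, hi⟩, ← heq i χ hχ hi ht']
    exact (χ.hasDerivAt i hi t (mem_interior_iff_mem_nhds.2 hn)).congr_of_eventuallyEq
      ((heq i χ hχ hi).symm.eventuallyEq_of_mem hn)
  · rintro i _ t ⟨χ, hχ, hi, ht⟩
    rw [← hp i χ ⟨hχ, hi⟩, ← heq i χ hχ hi ht]
    exact χ.mem_domain i hi t ht
  · intro i hi
    obtain ⟨χ, hχ, hi⟩ := hlen _ hi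
    rw [← hp i χ ⟨hχ, hlt hi⟩, ← hp _ χ ⟨hχ, hi⟩]
    exact χ.edge_mem i hi
  · intro i hi
    obtain ⟨χ, hχ, hi⟩ := hlen _ hi
    rw [← hp i χ ⟨hχ, hlt hi⟩, ← hp _ χ ⟨hχ, hi⟩, ← hτ _ χ ⟨hχ, hi⟩,
      ← heq i χ hχ (hlt hi) (χ.isGreatest i hi).1]
    exact χ.mem_guard i hi
  · intro i hi
    obtain ⟨χ, hχ, hi⟩ := hlen _ hi
    rw [← hp i χ ⟨hχ, hlt hi⟩, ← hp _ χ ⟨hχ, hi⟩, ← hτ _ χ ⟨hχ, hi⟩,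
      ← heq i χ hχ (hlt hi) (χ.isGreatest i hi).1, ← heq _ χ hχ hi (χ.isLeast _ hi).1]
    exact χ.reset_eq i hi

theorem exists_startsAt {q₀ : Q} {x₀ : EuclideanSpace ℝ (Fin n)} (hx : x₀ ∈ H.domain q₀) :
    ∃ χ : H.Execution, χ.StartsAt q₀ x₀ := by
  have hlt : ∀ i : ℕ, ¬ ((i + 1 : ℕ) : ℕ∞) < 1 := fun i hi => by
    have : i + 1 < 1 := by exact_mod_cast hi
    omega
  exact ⟨{
    len := 1, τ := fun _ => 0, T := fun _ => {0}, p := fun _ => q₀, c := fun _ _ => x₀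
    len_pos := zero_lt_one
    τ_zero := rfl
    ordConnected := fun _ _ => Set.ordConnected_singleton
    isLeast := fun _ _ => isLeast_singleton
    isGreatest := fun _ _ => isGreatest_singleton
    continuousOn := fun _ _ => continuousOn_const
    hasDerivAt := fun _ _ t ht => by simp at ht
    mem_domain := fun _ _ _ _ => hx
    edge_mem := fun i hi => (hlt i hi).elim
    mem_guard := fun i hi => (hlt i hi).elim
    reset_eq := fun i hi => (hlt i hi).elim }, rfl, rfl⟩

theorem exists_isMaximal {q₀ : Q} {x₀ : EuclideanSpace ℝ (Fin n)} (hx : x₀ ∈ H.domain q₀) :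
    ∃ χ : H.Execution, χ.StartsAt q₀ x₀ ∧ χ.IsMaximal := by
  obtain ⟨χ₀, hχ₀⟩ := exists_startsAt hx
  have : Nonempty {χ : H.Execution // χ.StartsAt q₀ x₀} := ⟨⟨χ₀, hχ₀⟩⟩
  obtain ⟨χ, hχ⟩ := exists_maximal_of_nonempty_chains_bounded
    (r := fun a b : {χ : H.Execution // χ.StartsAt q₀ x₀} => a.1.IsPrefix b.1)
    (fun C hC ⟨χ, hχ⟩ => by
      obtain ⟨ub, hub⟩ := exists_upperBound_of_isChain
        (C := Subtype.val '' C) (by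
          rintro _ ⟨a, ha, rfl⟩ _ ⟨b, hb, rfl⟩ hab
          exact hC ha hb fun h => hab (h ▸ rfl)) ⟨_, χ, hχ, rfl⟩
      exact ⟨⟨ub, χ.2.of_isPrefix (hub _ ⟨χ, hχ, rfl⟩)⟩, fun a ha => hub _ ⟨a, ha, rfl⟩⟩)
    (fun h h' => h.trans h')
  exact ⟨χ.1, χ.2, fun χ' h => hχ ⟨χ', χ.2.of_isPrefix h⟩ h⟩

end Execution

end HybridSystem

/-! ### Maximal trapped executions are infinite -/

/-- One-sided limits of the derivative give one-sided derivatives. This is what makes two solutions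
glued at a point a solution there. -/
theorem HasDerivAt.of_forall_mem_Ioo_ne {E : Type*} [NormedAddCommGroup E] [NormedSpace ℝ E]
    {f g : ℝ → E} {a b x : ℝ} (hax : a < x) (hxb : x < b)
    (hd : ∀ y ∈ Set.Ioo a b, y ≠ x → HasDerivAt f (g y) y) (hf : ContinuousAt f x)
    (hg : ContinuousAt g x) : HasDerivAt f (g x) x := by
  have hl : ∀ y ∈ Set.Ioo a x, HasDerivAt f (g y) y :=
    fun y hy => hd y ⟨hy.1, hy.2.trans hxb⟩ hy.2.ne
  have hr : ∀ y ∈ Set.Ioo x b, HasDerivAt f (g y) y :=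
    fun y hy => hd y ⟨hax.trans hy.1, hy.2⟩ hy.1.ne'
  have A : HasDerivWithinAt f (g x) (Set.Iic x) x := by
    refine hasDerivWithinAt_Iic_of_tendsto_deriv
      (fun y hy => (hl y hy).differentiableAt.differentiableWithinAt) hf.continuousWithinAt
      (Ioo_mem_nhdsLT hax) ((hg.tendsto.mono_left nhdsWithin_le_nhds).congr' ?_)
    filter_upwards [Ioo_mem_nhdsLT hax] with y hy using (hl y hy).deriv.symm
  have B : HasDerivWithinAt f (g x) (Set.Ici x) x := by
    refine hasDerivWithinAt_Ici_of_tendsto_deriv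
      (fun y hy => (hr y hy).differentiableAt.differentiableWithinAt) hf.continuousWithinAt
      (Ioo_mem_nhdsGT hxb) ((hg.tendsto.mono_left nhdsWithin_le_nhds).congr' ?_)
    filter_upwards [Ioo_mem_nhdsGT hxb] with y hy using (hr y hy).deriv.symm
  simpa [Set.Iic_union_Ici] using A.union B

/-- A curve with bounded velocity on an interval that is bounded and open on the right has a
limit at the right end. -/
theorem exists_tendsto_of_norm_deriv_le {E : Type*} [NormedAddCommGroup E] [NormedSpace ℝ E]
    [CompleteSpace E] {f f' : ℝ → E} {a b M : ℝ} (hab : a < b)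
    (hd : ∀ t ∈ Set.Ioo a b, HasDerivAt f (f' t) t) (hM : ∀ t ∈ Set.Ioo a b, ‖f' t‖ ≤ M) :
    ∃ L, Tendsto f (𝓝[<] b) (𝓝 L) := by
  have hlip : LipschitzOnWith M.toNNReal f (Set.Ioo a b) :=
    (convex_Ioo a b).lipschitzOnWith_of_nnnorm_hasDerivWithin_le
      (fun t ht => (hd t ht).hasDerivWithinAt) fun t ht =>
        NNReal.coe_le_coe.1 ((hM t ht).trans (Real.le_coe_toNNReal M))
  have hc : Cauchy (𝓝[<] b) := cauchy_nhds.mono nhdsWithin_le_nhds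
  exact CompleteSpace.complete
    (hc.map_of_le hlip.uniformContinuousOn (le_principal_iff.2 (Ioo_mem_nhdsLT hab)))

namespace HybridSystem

variable {Q : Type*} {n : ℕ} {H : HybridSystem Q n}

namespace Execution

variable {χ : H.Execution}

/-- Replacing the last interval and its curve by the larger ones yields an extension, which
maximality forces to be improper. -/
theorem IsMaximal.eq_of_extension (hχ : χ.IsMaximal) {N : ℕ} (hN : χ.len = (N + 1 : ℕ))
    {T : Set ℝ} {c : ℝ → EuclideanSpace ℝ (Fin n)} (hT : T.OrdConnected)
    (hl : IsLeast T (χ.τ N)) (hcont : ContinuousOn c T)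
    (hd : ∀ t ∈ interior T, HasDerivAt c (H.field (χ.p N) (c t)) t)
    (hD : ∀ t ∈ T, c t ∈ H.domain (χ.p N)) (hsub : χ.T N ⊆ T)
    (heq : Set.EqOn (χ.c N) c (χ.T N)) : χ.T N = T := by
  have hlt : ∀ i : ℕ, (i : ℕ∞) < χ.len ↔ i < N + 1 := fun i => by rw [hN]; exact_mod_cast Iff.rfl
  have hNlt : (N : ℕ∞) < χ.len := (hlt N).2 N.lt_succ_self
  have hne : ∀ {i : ℕ}, ((i + 1 : ℕ) : ℕ∞) < χ.len → i ≠ N := fun hi => by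
    have := (hlt _).1 hi
    omega
  let χ' : H.Execution := { χ with
    T := Function.update χ.T N T
    c := Function.update χ.c N c
    ordConnected := fun i hi => by
      by_cases h : i = N
      · subst h; simpa using hT
      · simpa [h] using χ.ordConnected i hi
    isLeast := fun i hi => by
      by_cases h : i = N
      · subst h; simpa using hl
      · simpa [h] using χ.isLeast i hi
    isGreatest := fun i hi => by simpa [hne hi] using χ.isGreatest i hi
    continuousOn := fun i hi => by
      by_cases h : i = N
      · subst h; simpa using hcont
      · simpa [h] using χ.continuousOn i hi
    hasDerivAt := fun i hi => by
      by_cases h : i = N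
      · subst h; simpa using hd
      · simpa [h] using χ.hasDerivAt i hi
    mem_domain := fun i hi => by
      by_cases h : i = N
      · subst h; simpa using hD
      · simpa [h] using χ.mem_domain i hi
    mem_guard := fun i hi => by simpa [hne hi] using χ.mem_guard i hi
    reset_eq := fun i hi => by
      by_cases h : i + 1 = N
      · subst h
        simpa [heq (χ.isLeast _ hi).1] using χ.reset_eq i hi
      · simpa [hne hi, h] using χ.reset_eq i hi }
  have hpre : χ.IsPrefix χ' := by
    refine ⟨le_rfl, fun i hi => ⟨rfl, rfl, ?_⟩⟩
    by_cases h : i = N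
    · subst h; simpa [χ'] using ⟨hsub, heq⟩
    · simp [χ', h, Set.eqOn_refl]
  have h := ((hχ χ' hpre).2 N hNlt).2.2.1
  exact hsub.antisymm (by simpa [χ'] using h)

/-- An enabled jump could be appended with the one-point interval `{b}`, on which no differential
equation has to be solved. -/
theorem IsMaximal.notMem_guard (hχ : χ.IsMaximal) {N : ℕ} (hN : χ.len = (N + 1 : ℕ))
    {b : ℝ} (hb : IsGreatest (χ.T N) b) {q : Q} (he : (χ.p N, q) ∈ H.edges) :
    χ.c N b ∉ H.guard (χ.p N, q) := by
  intro hg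
  have hlt : ∀ i : ℕ, (i : ℕ∞) < χ.len ↔ i < N + 1 := fun i => by rw [hN]; exact_mod_cast Iff.rfl
  have hlt' : ∀ {i : ℕ}, (i : ℕ∞) < (N + 2 : ℕ) → (i : ℕ∞) < χ.len ∨ i = N + 1 := fun {i} hi => by
    have : i < N + 2 := by exact_mod_cast hi
    rw [hlt]
    omega
  have hNlt : ∀ i : ℕ, (i : ℕ∞) < χ.len → i ≠ N + 1 := fun i hi => ((hlt i).1 hi).ne
  have hNlt' : ∀ {i : ℕ}, ((i + 1 : ℕ) : ℕ∞) < χ.len → i ≠ N + 1 :=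
    fun hi => hNlt _ (χ.lt_len_of_succ hi)
  have hne : ∀ {i : ℕ}, ((i + 1 : ℕ) : ℕ∞) < χ.len → i ≠ N :=
    fun hi h => hNlt _ hi (h ▸ rfl)
  let χ' : H.Execution := {
    len := (N + 2 : ℕ)
    τ := Function.update χ.τ (N + 1) b
    T := Function.update χ.T (N + 1) {b}
    p := Function.update χ.p (N + 1) q
    c := Function.update χ.c (N + 1) fun _ => H.reset (χ.p N, q) (χ.c N b)
    len_pos := by exact_mod_cast Nat.succ_pos _
    τ_zero := by simpa using χ.τ_zero
    ordConnected := fun i hi => by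
      rcases hlt' hi with h | rfl
      · simpa [hNlt i h] using χ.ordConnected i h
      · simpa using Set.ordConnected_singleton
    isLeast := fun i hi => by
      rcases hlt' hi with h | rfl
      · simpa [hNlt i h] using χ.isLeast i h
      · simp
    isGreatest := fun i hi => by
      rcases hlt' hi with h | h
      · simpa [hNlt' h, hne h] using χ.isGreatest i h
      · obtain rfl : i = N := by omega
        simpa using hb
    continuousOn := fun i hi => by
      rcases hlt' hi with h | rfl
      · simpa [hNlt i h] using χ.continuousOn i h
      · simp
    hasDerivAt := fun i hi => by
      rcases hlt' hi with h | rfl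
      · simpa [hNlt i h] using χ.hasDerivAt i h
      · simp
    mem_domain := fun i hi => by
      rcases hlt' hi with h | rfl
      · simpa [hNlt i h] using χ.mem_domain i h
      · simpa using reset_mem_domain he hg
    edge_mem := fun i hi => by
      rcases hlt' hi with h | h
      · simpa [hNlt' h, hne h] using χ.edge_mem i h
      · obtain rfl : i = N := by omega
        simpa using he
    mem_guard := fun i hi => by
      rcases hlt' hi with h | h
      · simpa [hNlt' h, hne h] using χ.mem_guard i h
      · obtain rfl : i = N := by omega
        simpa using hg
    reset_eq := fun i hi => by
      rcases hlt' hi with h | h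
      · simpa [hNlt' h, hne h] using χ.reset_eq i h
      · obtain rfl : i = N := by omega
        simp }
  have hpre : χ.IsPrefix χ' := by
    refine ⟨?_, fun i hi => ?_⟩
    · exact hN.trans_le (Nat.cast_le.2 (Nat.le_succ _))
    · simp [χ', hNlt i hi, Set.eqOn_refl]
  have h : ((N + 2 : ℕ) : ℕ∞) ≤ χ.len := (hχ χ' hpre).1
  rw [hN] at h
  have : N + 2 ≤ N + 1 := by exact_mod_cast h
  omega

/-- In a maximal execution with a last interval on which the velocity is bounded, the last interval
contains its right end if it is bounded. -/
theorem IsMaximal.exists_isGreatest (hχ : χ.IsMaximal) {N : ℕ} (hN : χ.len = (N + 1 : ℕ))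
    (hb : BddAbove (χ.T N)) {M : ℝ} (hM : ∀ t ∈ χ.T N, ‖H.field (χ.p N) (χ.c N t)‖ ≤ M) :
    ∃ b, IsGreatest (χ.T N) b := by
  have hlt : (N : ℕ∞) < χ.len := by rw [hN]; exact_mod_cast N.lt_succ_self
  have hτ := χ.isLeast N hlt
  have hlub := isLUB_csSup ⟨_, hτ.1⟩ hb
  set b := sSup (χ.T N)
  refine ⟨b, ?_, hlub.1⟩
  by_contra hbT
  have hT : χ.T N = Set.Ico (χ.τ N) b := by
    ext t
    refine ⟨fun ht => ⟨hτ.2 ht, (hlub.1 ht).lt_of_ne fun h => hbT (h ▸ ht)⟩, fun ht => ?_⟩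
    obtain ⟨s, hs, hts, -⟩ := hlub.exists_between ht.2
    exact χ.Icc_subset hlt hs ⟨ht.1, hts.le⟩
  have hτb : χ.τ N < b := (hT ▸ hτ.1 : χ.τ N ∈ Set.Ico (χ.τ N) b).2
  have hcont := χ.continuousOn N hlt
  have hd := χ.hasDerivAt N hlt
  have hD := χ.mem_domain N hlt
  rw [hT] at hcont hd hD hM
  rw [interior_Ico] at hd
  obtain ⟨L, hL⟩ := exists_tendsto_of_norm_deriv_le hτb hd fun t ht => hM t ⟨ht.1.le, ht.2⟩
  have hLD : L ∈ H.domain (χ.p N) := by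
    refine (H.isClosed_domain _).mem_of_tendsto hL ?_
    filter_upwards [Ico_mem_nhdsLT hτb] with t ht using hD t ht
  -- A half-open last interval could be closed up by the limit `L`, which lies in the closed domain.
  have h := hχ.eq_of_extension hN (T := Set.Icc (χ.τ N) b) (c := Function.update (χ.c N) b L)
    Set.ordConnected_Icc (isLeast_Icc hτb.le) ?_ ?_ ?_ (hT ▸ Set.Ico_subset_Icc_self) ?_
  · exact hbT (h ▸ Set.right_mem_Icc.2 hτb.le)
  · rw [continuousOn_update_iff, Set.Icc_sdiff_right]
    refine ⟨hcont, fun _ => ?_⟩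
    rwa [nhdsWithin_Ico_eq_nhdsLT hτb]
  · rw [interior_Icc]
    intro t ht
    have hev : Function.update (χ.c N) b L =ᶠ[𝓝 t] χ.c N := by
      filter_upwards [Iio_mem_nhds ht.2] with s hs using Function.update_of_ne hs.ne _ _
    rw [hev.eq_of_nhds]
    exact (hd t ht).congr_of_eventuallyEq hev
  · intro t ht
    rcases ht.2.eq_or_lt with rfl | h
    · simpa using hLD
    · simpa [h.ne] using hD t ⟨ht.1, h⟩
  · intro t ht
    rw [hT] at ht
    simp [ht.2.ne]

theorem IsMaximal.not_exists_solution (hχ : χ.IsMaximal) {N : ℕ} (hN : χ.len = (N + 1 : ℕ))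
    {b : ℝ} (hb : IsGreatest (χ.T N) b) {δ : ℝ} (hδ : 0 < δ)
    {y : ℝ → EuclideanSpace ℝ (Fin n)} (hy0 : y 0 = χ.c N b)
    (hy : ContinuousOn y (Set.Icc 0 δ))
    (hyd : ∀ t ∈ Set.Ioo 0 δ, HasDerivAt y (H.field (χ.p N) (y t)) t)
    (hyD : ∀ t ∈ Set.Icc 0 δ, y t ∈ H.domain (χ.p N)) : False := by
  have hlt : (N : ℕ∞) < χ.len := by rw [hN]; exact_mod_cast N.lt_succ_self
  have hτ := χ.isLeast N hlt
  have hτb := hτ.2 hb.1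
  have hT : χ.T N = Set.Icc (χ.τ N) b :=
    Set.Subset.antisymm (fun t ht => ⟨hτ.2 ht, hb.2 ht⟩) (χ.Icc_subset hlt hb.1)
  have hcont := χ.continuousOn N hlt
  have hd := χ.hasDerivAt N hlt
  have hD := χ.mem_domain N hlt
  rw [hT] at hcont hd hD
  rw [interior_Icc] at hd
  set c : ℝ → EuclideanSpace ℝ (Fin n) := fun t => if t ≤ b then χ.c N t else y (t - b) with hc
  have hcl : ∀ t, t ≤ b → c t = χ.c N t := fun t ht => if_pos ht
  have hcr : ∀ t, b ≤ t → c t = y (t - b) := fun t ht => by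
    rcases ht.eq_or_lt with rfl | h
    · simp [hc, hy0]
    · exact if_neg h.not_ge
  have hunion : Set.Icc (χ.τ N) b ∪ Set.Icc b (b + δ) = Set.Icc (χ.τ N) (b + δ) :=
    Set.Icc_union_Icc_eq_Icc hτb (by linarith)
  have hccont : ContinuousOn c (Set.Icc (χ.τ N) (b + δ)) := by
    rw [← hunion]
    refine ContinuousOn.union_of_isClosed (hcont.congr fun t ht => hcl t ht.2) ?_
      isClosed_Icc isClosed_Icc
    refine ContinuousOn.congr (hy.comp (f := fun t => t - b) (by fun_prop) ?_)
      fun t ht => hcr t ht.1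
    exact fun t ht => ⟨by linarith [ht.1], by linarith [ht.2]⟩
  have hcd : ∀ t ∈ Set.Ioo (χ.τ N) (b + δ), t ≠ b →
      HasDerivAt c (H.field (χ.p N) (c t)) t := by
    intro t ht htb
    rcases htb.lt_or_gt with h | h
    · rw [hcl t h.le]
      refine (hd t ⟨ht.1, h⟩).congr_of_eventuallyEq ?_
      filter_upwards [Iio_mem_nhds h] with s hs using hcl s hs.le
    · rw [hcr t h.le]
      refine ((hyd (t - b) ⟨by linarith, by linarith [ht.2]⟩).comp_sub_const t b)
        |>.congr_of_eventuallyEq ?_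
      filter_upwards [Ioi_mem_nhds h] with s hs using hcr s hs.le
  have h := hχ.eq_of_extension hN (T := Set.Icc (χ.τ N) (b + δ)) (c := c)
    Set.ordConnected_Icc (isLeast_Icc (by linarith)) hccont ?_ ?_
    (hT ▸ Set.Icc_subset_Icc_right (by linarith)) fun t ht => (hcl t (hb.2 ht)).symm
  · have := hb.2 (h ▸ Set.right_mem_Icc.2 (by linarith) : b + δ ∈ χ.T N)
    linarith
  · rw [interior_Icc]
    intro t ht
    by_cases htb : t = b
    · subst htb
      -- At the junction neither piece is known to be differentiable; continuity of the curve and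
      -- the field supplies the derivative.
      have hct : ContinuousAt c t := hccont.continuousAt (Icc_mem_nhds ht.1 ht.2)
      exact HasDerivAt.of_forall_mem_Ioo_ne (g := fun t => H.field (χ.p N) (c t)) ht.1 ht.2 hcd hct
        ((H.continuous_field _).continuousAt.comp hct)
    · exact hcd t ht htb
  · intro t ht
    rcases le_total t b with h | h
    · rw [hcl t h]
      exact hD t ⟨ht.1, h⟩
    · rw [hcr t h]
      exact hyD _ ⟨by linarith, by linarith [ht.2]⟩

variable {z : Q → EuclideanSpace ℝ (Fin n)} {Kw : Q → ℕ}
  {w : (q : Q) → Fin (Kw q) → MvPolynomial (Fin n) ℝ}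
  {S : H.FeasibilitySolution z w} {ε κ : ℝ}

theorem IsMaximal.isInfinite (hχ : χ.IsMaximal) (hS : S.IsTrapping ε κ)
    (h0 : χ.c 0 0 ∈ S.sublevel ε κ (χ.p 0))
    (hnb : ∀ q, ∀ x ∈ S.sublevel ε κ q, (∃ e ∈ H.edges, e.1 = q ∧ x ∈ H.guard e) ∨
      ∃ δ : ℝ, 0 < δ ∧ ∃ y : ℝ → EuclideanSpace ℝ (Fin n), y 0 = x ∧
        ContinuousOn y (Set.Icc 0 δ) ∧ (∀ t ∈ Set.Ioo 0 δ, HasDerivAt y (H.field q (y t)) t) ∧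
        ∀ t ∈ Set.Icc 0 δ, y t ∈ H.domain q) : χ.IsInfinite := by
  by_contra hinf
  simp only [IsInfinite, not_or, not_exists, not_and, not_not] at hinf
  obtain ⟨hfin, hbdd⟩ := hinf
  lift χ.len to ℕ using hfin with m hm
  obtain ⟨N, rfl⟩ : ∃ N, m = N + 1 := Nat.exists_eq_succ_of_ne_zero fun h => by
    have := χ.len_pos
    simp [← hm, h] at this
  have hN := hm.symm
  have hlt : (N : ℕ∞) < χ.len := by rw [hN]; exact_mod_cast N.lt_succ_self
  have hmem := fun t ht => (mem_sublevel hS h0 N hlt t ht).1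
  obtain ⟨M, hM⟩ := (isCompact_closedBall (0 : EuclideanSpace ℝ (Fin n)) ε)
    |>.exists_bound_of_continuousOn (H.continuous_field (χ.p N)).continuousOn
  obtain ⟨b, hb⟩ := hχ.exists_isGreatest hN (hbdd N (by exact_mod_cast N.lt_succ_self))
    fun t ht => hM _ (by simpa using (hmem t ht).2.1.le)
  rcases hnb _ _ (hmem b hb.1) with ⟨⟨q, q'⟩, he, rfl, hg⟩ | ⟨δ, hδ, y, hy0, hy, hyd, hyD⟩
  · exact hχ.notMem_guard hN hb he hg
  · exact hχ.not_exists_solution hN hb hδ hy0 hy hyd hyD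

end Execution

end HybridSystem

theorem mainTheorem1 {Q : Type*} [Finite Q] {n : ℕ} (H : HybridSystem Q n)
    (hcyc : H.IsCyclic) (z : Q → EuclideanSpace ℝ (Fin n)) (hz : H.IsZenoEquilibrium z)
    {Kw : Q → ℕ} (w : (q : Q) → Fin (Kw q) → MvPolynomial (Fin n) ℝ)
    (hW : ∀ q, H.nbhd w q ∈ 𝓝[H.domain q] (z q))
    (hsol : Nonempty (H.FeasibilitySolution z w)) :
    H.ZenoStableForInfinite z ∧ (H.NonBlockingNear z → H.ZenoStable z) := by
  obtain ⟨S⟩ := hsol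
  have hz0 : ∀ q, z q = 0 := fun q =>
    HybridSystem.FeasibilitySolution.eq_zero_of_mem_nbhd S
      (mem_of_mem_nhdsWithin (hz.mem_domain q) (hW q))
  have hZ : ∀ {ε κ : ℝ}, 0 < ε → 0 < κ → ∀ q, S.sublevel ε κ q ⊆ H.domain q ∧
      z q ∈ S.sublevel ε κ q ∧ S.sublevel ε κ q ∈ 𝓝[H.domain q] (z q) := fun hε hκ q =>
    have h := S.sublevel_mem_nhdsWithin hε hκ (hz0 q)
    ⟨fun x hx => hx.1, mem_of_mem_nhdsWithin (hz.mem_domain q) h, h⟩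
  have hstart : ∀ {ε κ : ℝ} {χ : H.Execution} {q₀ : Q} {x₀ : EuclideanSpace ℝ (Fin n)},
      χ.StartsAt q₀ x₀ → x₀ ∈ S.sublevel ε κ q₀ → χ.c 0 0 ∈ S.sublevel ε κ (χ.p 0) := by
    rintro ε κ χ q₀ x₀ ⟨rfl, rfl⟩ h
    exact h
  refine ⟨?_, fun hnb => ?_⟩
  · obtain ⟨ε, κ, hε, hκ, hS, -⟩ := S.exists_isTrapping hz hz0 hW hW
    exact ⟨S.sublevel ε κ, hZ hε hκ, fun q₀ x₀ hx₀ χ hχ hinf =>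
      HybridSystem.Execution.isZeno_and_convergesTo hcyc hz0 hS (hstart hχ hx₀) hinf⟩
  · obtain ⟨ε, κ, hε, hκ, hS, hP⟩ := S.exists_isTrapping hz hz0 hW hnb
    refine ⟨S.sublevel ε κ, hZ hε hκ, fun q₀ x₀ hx₀ =>
      ⟨HybridSystem.Execution.exists_isMaximal hx₀.1, fun χ hχ hmax => ?_⟩⟩
    have h0 := hstart hχ hx₀
    exact HybridSystem.Execution.isZeno_and_convergesTo hcyc hz0 hS h0
      (hmax.isInfinite hS h0 fun q x hx => hP q hx)
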